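/- Let $X$ be a separable compact Hausdorff space. Suppose that either $X$ is scattered, i.e. every nonempty subspace of $X$ has an isolated point, or $X$ has countable tightness, i.e. whenever $x \in X$ and $A \subseteq X$ satisfy $x \in \overline{A}$, there is a countable set $E \subseteq A$ with $x \in \overline{E}$. Then every Hausdorff space $Y$ that is the image of $X$ under a continuous surjection is S-separable, i.e. for every sequence $(Y_n)_{n\in\mathbb{N}}$ of dense subspaces of $Y$ there exist finite sets $F_n \subseteq Y_n$ ($n \in \mathbb{N}$) such that for each finite collection $\mathcal{U}$ of nonempty open subsets of $Y$ there is an $n \in \mathbb{N}$ with $U \cap F_n \neq \emptyset$ for all $U \in \mathcal{U}$. -/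

import Mathlib

/-- A space is scattered if every nonempty subspace `S` has an isolated point, i.e. a point `x ∈ S`
such that `{x}` is open in `S`. -/
def ScatteredSpace (X : Type*) [TopologicalSpace X] : Prop :=
  ∀ S : Set X, S.Nonempty → ∃ x ∈ S, ∃ U : Set X, IsOpen U ∧ U ∩ S = {x}

/-- A space has countable tightness if every point of the closure of a set lies in the closure of
a countable subset of that set. -/
def CountablyTightSpace (X : Type*) [TopologicalSpace X] : Prop :=
  ∀ (x : X) (S : Set X), x ∈ closure S → ∃ E : Set X, E ⊆ S ∧ E.Countable ∧ x ∈ closure E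

/-- A space is S-separable if from every sequence `D` of dense sets one can choose finite sets
`F n ⊆ D n` such that for each finite collection of nonempty open sets some single `F n` meets
all the members of the collection. -/
def SSeparableSpace (X : Type*) [TopologicalSpace X] : Prop :=
  ∀ D : ℕ → Set X, (∀ n, Dense (D n)) →
    ∃ F : ℕ → Set X, (∀ n, (F n).Finite ∧ F n ⊆ D n) ∧
      ∀ 𝒰 : Set (Set X), 𝒰.Finite → (∀ U ∈ 𝒰, IsOpen U ∧ U.Nonempty) →
        ∃ n, ∀ U ∈ 𝒰, (U ∩ F n).Nonempty

/-! A countable π-base yields S-separability, so one is sought in the compact separable space `Y`.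
If `X` is scattered, restrict `f` to a minimal closed set mapping onto `Y`: its relatively isolated
points map to isolated points, which are thus dense in `Y` and lie in every dense set. Countable
tightness passes to `Y`. A point without a countable local π-base would give a free sequence of
length ω₁ (Šapirovskiĭ), which tightness and compactness forbid; local π-bases over a countable
dense set then unite to a π-base. -/

/-- A family of nonempty open sets such that every nonempty open set contains a member. -/
def IsPiBase {Y : Type*} [TopologicalSpace Y] (B : Set (Set Y)) : Prop :=
  (∀ b ∈ B, IsOpen b ∧ b.Nonempty) ∧ ∀ U : Set Y, IsOpen U → U.Nonempty → ∃ b ∈ B, b ⊆ U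

/-- A family of nonempty open sets such that every open neighbourhood of `p` contains a member. -/
def IsLocalPiBase {Y : Type*} [TopologicalSpace Y] (p : Y) (B : Set (Set Y)) : Prop :=
  (∀ b ∈ B, IsOpen b ∧ b.Nonempty) ∧ ∀ U : Set Y, IsOpen U → p ∈ U → ∃ b ∈ B, b ⊆ U

theorem IsPiBase.sSeparableSpace {Y : Type*} [TopologicalSpace Y] {B : Set (Set Y)}
    (hB : IsPiBase B) (hc : B.Countable) : SSeparableSpace Y := by
  intro D hD
  obtain ⟨e, he⟩ := Set.countable_iff_exists_injective.mp hc
  have hpt : ∀ (n : ℕ) (b : B), ∃ y, y ∈ b.1 ∩ D n := fun n b =>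
    (hD n).inter_open_nonempty b.1 (hB.1 b b.2).1 (hB.1 b b.2).2
  choose pt hpt using hpt
  -- `F n` has one point of `D n` in each member of `B` with code at most `n`; a finite collection
  -- needs only finitely many members.
  refine ⟨fun n => pt n '' {b | e b ≤ n}, fun n => ⟨?_, ?_⟩, ?_⟩
  · exact ((Set.finite_Iic n).preimage he.injOn).image _
  · rintro _ ⟨b, -, rfl⟩
    exact (hpt n b).2
  · intro 𝒰 hfin hU
    have hb : ∀ U : 𝒰, ∃ b : B, b.1 ⊆ U.1 := fun U => by
      obtain ⟨b, hb, hbU⟩ := hB.2 U (hU U U.2).1 (hU U U.2).2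
      exact ⟨⟨b, hb⟩, hbU⟩
    choose β hβ using hb
    have := hfin.to_subtype
    obtain ⟨n, hn⟩ := (Set.finite_range fun U : 𝒰 => e (β U)).bddAbove
    refine ⟨n, fun U hUm => ⟨pt n (β ⟨U, hUm⟩), hβ ⟨U, hUm⟩ (hpt n _).1, ?_⟩⟩
    exact ⟨β ⟨U, hUm⟩, hn ⟨⟨U, hUm⟩, rfl⟩, rfl⟩

theorem exists_countable_isPiBase_of_isLocalPiBase {Y : Type*} [TopologicalSpace Y]
    [TopologicalSpace.SeparableSpace Y]
    (h : ∀ p : Y, ∃ B : Set (Set Y), B.Countable ∧ IsLocalPiBase p B) :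
    ∃ B : Set (Set Y), B.Countable ∧ IsPiBase B := by
  obtain ⟨s, hs, hd⟩ := TopologicalSpace.exists_countable_dense Y
  choose B hBc hB using h
  refine ⟨⋃ p ∈ s, B p, hs.biUnion fun p _ => hBc p, ?_, fun U hU hne => ?_⟩
  · intro b hb
    simp only [Set.mem_iUnion] at hb
    obtain ⟨p, -, hb⟩ := hb
    exact (hB p).1 b hb
  · obtain ⟨p, hpU, hps⟩ := hd.inter_open_nonempty U hU hne
    obtain ⟨b, hb, hbU⟩ := (hB p).2 U hU hpU
    exact ⟨b, Set.mem_biUnion hps hb, hbU⟩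

open Set Topology in
/-- A continuous surjection of a compact space is irreducible on some closed subset. -/
theorem exists_minimal_closed_surjOn {X Y : Type*} [TopologicalSpace X] [TopologicalSpace Y]
    [CompactSpace X] [T1Space Y] {f : X → Y} (hf : Continuous f) (hs : Function.Surjective f) :
    ∃ E : Set X, Minimal (fun E => IsClosed E ∧ f '' E = univ) E := by
  refine zorn_superset {E : Set X | IsClosed E ∧ f '' E = univ} fun C hCS hC => ?_
  rcases C.eq_empty_or_nonempty with rfl | hne
  · exact ⟨univ, ⟨isClosed_univ, image_univ_of_surjective hs⟩, by simp⟩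
  refine ⟨⋂₀ C, ⟨isClosed_sInter fun c hc => (hCS hc).1, eq_univ_of_forall fun y => ?_⟩,
    fun c hc => sInter_subset_of_mem hc⟩
  have := hne.to_subtype
  have hcl : ∀ c : C, IsClosed (c.1 ∩ f ⁻¹' {y}) := fun c =>
    (hCS c.2).1.inter (isClosed_singleton.preimage hf)
  have hdir : Directed (· ⊇ ·) fun c : C => c.1 ∩ f ⁻¹' {y} := fun a b => by
    rcases hC.total a.2 b.2 with h | h
    · exact ⟨a, subset_rfl, inter_subset_inter_left _ h⟩
    · exact ⟨b, inter_subset_inter_left _ h, subset_rfl⟩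
  have hnonempty : ∀ c : C, (c.1 ∩ f ⁻¹' {y}).Nonempty := fun c => by
    have : y ∈ f '' c.1 := (hCS c.2).2 ▸ mem_univ y
    exact this
  obtain ⟨x, hx⟩ := IsCompact.nonempty_iInter_of_directed_nonempty_isCompact_isClosed
    _ hdir hnonempty (fun c => (hcl c).isCompact) hcl
  rw [mem_iInter] at hx
  exact ⟨x, fun c hc => (hx ⟨c, hc⟩).1, (hx (Classical.arbitrary C)).2⟩

/-- In the image of a scattered compact space, isolated points are dense. -/
theorem ScatteredSpace.exists_isOpen_singleton {X Y : Type*} [TopologicalSpace X]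
    [TopologicalSpace Y] [CompactSpace X] [T2Space Y] (hX : ScatteredSpace X)
    {f : X → Y} (hf : Continuous f) (hs : Function.Surjective f) {U : Set Y} (hU : IsOpen U)
    (hne : U.Nonempty) : ∃ y ∈ U, IsOpen ({y} : Set Y) := by
  obtain ⟨E, ⟨hE, hEf⟩, hmin⟩ := exists_minimal_closed_surjOn hf hs
  obtain ⟨u, hu⟩ := hne
  have hsurj : ∀ y, ∃ x ∈ E, f x = y := fun y => by
    have : y ∈ f '' E := hEf ▸ Set.mem_univ y
    exact this
  obtain ⟨x₀, hx₀, rfl⟩ := hsurj u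
  obtain ⟨x, ⟨hxE, hxU⟩, W, hW, hWx⟩ := hX (E ∩ f ⁻¹' U) ⟨x₀, hx₀, hu⟩
  refine ⟨f x, hxU, ?_⟩
  have hxW : x ∈ W := (hWx ▸ Set.mem_singleton x : x ∈ W ∩ (E ∩ f ⁻¹' U)).1
  -- This removes just `x` from `E`. By minimality the image loses a point, which can only be `f x`.
  set E' := E \ (W ∩ f ⁻¹' U) with hE'
  have hE'c : IsClosed E' := hE.sdiff (hW.inter (hU.preimage hf))
  have hne' : f '' E' ≠ Set.univ := fun h =>
    (hmin ⟨hE'c, h⟩ Set.sdiff_subset hxE).2 ⟨hxW, hxU⟩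
  have key : ∀ y, y ∉ f '' E' → y = f x := by
    intro y hy
    obtain ⟨z, hz, rfl⟩ := hsurj y
    have hzW : z ∈ W ∩ f ⁻¹' U := by
      by_contra h
      exact hy ⟨z, ⟨hz, h⟩, rfl⟩
    have : z ∈ ({x} : Set X) := hWx ▸ ⟨hzW.1, hz, hzW.2⟩
    rw [Set.mem_singleton_iff.mp this]
  obtain ⟨y, hy⟩ := (Set.ne_univ_iff_exists_notMem _).mp hne'
  have : ({f x} : Set Y) = (f '' E')ᶜ := by
    ext z
    refine ⟨?_, key z⟩
    rintro rfl
    rwa [← key y hy]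
  rw [this]
  exact (hE'c.isCompact.image hf).isClosed.isOpen_compl

theorem exists_countable_isPiBase_of_dense_isolated {Y : Type*} [TopologicalSpace Y]
    [TopologicalSpace.SeparableSpace Y]
    (h : ∀ U : Set Y, IsOpen U → U.Nonempty → ∃ y ∈ U, IsOpen ({y} : Set Y)) :
    ∃ B : Set (Set Y), B.Countable ∧ IsPiBase B := by
  obtain ⟨s, hs, hd⟩ := TopologicalSpace.exists_countable_dense Y
  refine ⟨(fun y => {y}) '' {y | IsOpen ({y} : Set Y)}, (hs.mono fun y hy => ?_).image _, ?_, ?_⟩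
  · obtain ⟨z, hz, hzs⟩ := hd.inter_open_nonempty {y} hy (Set.singleton_nonempty y)
    rwa [← Set.mem_singleton_iff.mp hz]
  · rintro _ ⟨y, hy, rfl⟩
    exact ⟨hy, Set.singleton_nonempty y⟩
  · intro U hU hne
    obtain ⟨y, hyU, hy⟩ := h U hU hne
    exact ⟨{y}, ⟨y, hy, rfl⟩, Set.singleton_subset_iff.mpr hyU⟩

theorem CountablyTightSpace.of_isClosedMap {X Y : Type*} [TopologicalSpace X]
    [TopologicalSpace Y] (hX : CountablyTightSpace X) {f : X → Y} (hf : Continuous f)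
    (hc : IsClosedMap f) (hs : Function.Surjective f) : CountablyTightSpace Y := by
  intro y S hy
  have hsub : S ⊆ f '' closure (f ⁻¹' S) := fun z hz => by
    obtain ⟨x, rfl⟩ := hs z
    exact ⟨x, subset_closure hz, rfl⟩
  obtain ⟨x, hx, rfl⟩ := closure_minimal hsub (hc _ isClosed_closure) hy
  obtain ⟨E, hES, hE, hxE⟩ := hX x _ hx
  exact ⟨f '' E, Set.image_subset_iff.mpr hES, hE.image f,
    image_closure_subset_closure_image hf ⟨x, hxE, rfl⟩⟩

/-- Well-founded recursion for a relational specification that depends only on earlier values. -/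
theorem exists_forall_of_wellFoundedLT {I α : Type*} [LinearOrder I] [WellFoundedLT I] [Nonempty α]
    (P : I → (I → α) → α → Prop)
    (hloc : ∀ i f g x, (∀ j < i, f j = g j) → P i f x → P i g x)
    (hex : ∀ i f, ∃ x, P i f x) : ∃ f : I → α, ∀ i, P i f (f i) := by
  classical
  choose g hg using hex
  let F : ∀ i, (∀ j, j < i → α) → α := fun i f =>
    g i fun j => if h : j < i then f j h else Classical.arbitrary α
  have hwf : WellFounded ((· < ·) : I → I → Prop) := wellFounded_lt
  refine ⟨hwf.fix F, fun i => ?_⟩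
  rw [hwf.fix_eq]
  refine hloc i _ _ _ (fun j hj => ?_) (hg i _)
  simp [hj]

open Set Topology in
/-- At a point without a countable local π-base there are neighbourhoods that are independent
enough to define a free sequence. -/
theorem exists_independent_neighborhoods {Y I : Type*} [TopologicalSpace Y] [RegularSpace Y]
    [LinearOrder I] [WellFoundedLT I] (hI : ∀ i : I, (Iio i).Countable) {p : Y}
    (hp : ¬ ∃ B : Set (Set Y), B.Countable ∧ IsLocalPiBase p B) :
    ∃ K V : I → Set Y, (∀ i, IsClosed (K i)) ∧ (∀ i, IsOpen (V i)) ∧ (∀ i, K i ⊆ V i) ∧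
      ∀ a b : Finset I, (∀ i ∈ a, ∀ j ∈ b, i < j) →
        ((⋂ i ∈ a, K i) ∩ ⋂ j ∈ b, (V j)ᶜ).Nonempty := by
  classical
  have hκ : ∀ V : Set Y, ∃ K : Set Y, IsOpen V → p ∈ V → K ∈ 𝓝 p ∧ IsClosed K ∧ K ⊆ V := by
    intro V
    by_cases h : IsOpen V ∧ p ∈ V
    · obtain ⟨K, hK⟩ := exists_mem_nhds_isClosed_subset (h.1.mem_nhds h.2)
      exact ⟨K, fun _ _ => hK⟩
    · exact ⟨∅, fun h1 h2 => absurd ⟨h1, h2⟩ h⟩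
  choose κ hκ using hκ
  let W : (I → Set Y) → Finset I → Finset I → Set Y := fun V a b =>
    (⋂ i ∈ a, interior (κ (V i))) ∩ ⋂ j ∈ b, (closure (V j))ᶜ
  have hWo : ∀ V a b, IsOpen (W V a b) := fun V a b =>
    (isOpen_biInter_finset fun _ _ => isOpen_interior).inter
      (isOpen_biInter_finset fun _ _ => isClosed_closure.isOpen_compl)
  -- No nonempty `W` built from earlier indices lies in `closure N`, so cutting `closure N` away
  -- never empties it.
  let P : I → (I → Set Y) → Set Y → Prop := fun i V N => IsOpen N ∧ p ∈ N ∧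
    ∀ a b : Finset I, (∀ j ∈ a, j < i) → (∀ j ∈ b, j < i) → (W V a b).Nonempty →
      ¬ W V a b ⊆ closure N
  obtain ⟨V, hV⟩ : ∃ V, ∀ i, P i V (V i) := by
    refine exists_forall_of_wellFoundedLT P ?_ ?_
    · rintro i f g N hfg ⟨h1, h2, h3⟩
      refine ⟨h1, h2, fun a b ha hb => ?_⟩
      have : W g a b = W f a b := by
        refine congrArg₂ (· ∩ ·) (iInter₂_congr fun j hj => ?_) (iInter₂_congr fun j hj => ?_)
        · rw [hfg j (ha j hj)]
        · rw [hfg j (hb j hj)]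
      rw [this]
      exact h3 a b ha hb
    · intro i f
      have hfc : {a : Finset I | (a : Set I) ⊆ Iio i}.Countable :=
        ((countable_ofPred_finite_subset (hI i)).preimage Finset.coe_injective).mono
          fun a ha => show _ ∧ _ from ⟨a.finite_toSet, ha⟩
      let B : Set (Set Y) := {w | w ∈ (fun q : Finset I × Finset I => W f q.1 q.2) ''
        ({a : Finset I | (a : Set I) ⊆ Iio i} ×ˢ {a : Finset I | (a : Set I) ⊆ Iio i}) ∧
        w.Nonempty}
      have hB : B.Countable := ((hfc.prod hfc).image _).mono fun w hw => hw.1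
      -- If no `N` works, the countably many earlier sets `W` form a local π-base at `p`.
      by_contra! hcon
      refine hp ⟨B, hB, ?_, fun U hU hpU => ?_⟩
      · rintro _ ⟨⟨q, -, rfl⟩, hne⟩
        exact ⟨hWo _ _ _, hne⟩
      · obtain ⟨K, hK, hKc, hKU⟩ := exists_mem_nhds_isClosed_subset (hU.mem_nhds hpU)
        have := hcon (interior K)
        simp only [P, not_and, not_forall, not_not] at this
        obtain ⟨a, b, ha, hb, hne, hsub⟩ := this isOpen_interior (mem_interior_iff_mem_nhds.mpr hK)
        exact ⟨W f a b, ⟨⟨(a, b), ⟨ha, hb⟩, rfl⟩, hne⟩,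
          hsub.trans ((closure_minimal interior_subset hKc).trans hKU)⟩
  have hK := fun i => hκ (V i) (hV i).1 (hV i).2.1
  have hne : ∀ a b : Finset I, (∀ i ∈ a, ∀ j ∈ b, i < j) → (W V a b).Nonempty := by
    intro a b
    -- The largest index `m` of `b` exceeds all the others, so the choice of `V m` applies to them.
    induction b using Finset.induction_on_max with
    | empty =>
      exact fun _ => ⟨p, by simpa [W] using fun i _ => mem_interior_iff_mem_nhds.mpr (hK i).1⟩
    | insert m b hm ih =>
      intro hab
      obtain ⟨y, hy, hyV⟩ := not_subset.mp <| (hV m).2.2 a b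
        (fun i hi => hab i hi m (Finset.mem_insert_self m b)) hm
        (ih fun i hi j hj => hab i hi j (Finset.mem_insert_of_mem hj))
      refine ⟨y, hy.1, ?_⟩
      rw [Finset.set_biInter_insert]
      exact ⟨hyV, hy.2⟩
  refine ⟨fun i => κ (V i), V, fun i => (hK i).2.1, fun i => (hV i).1, fun i => (hK i).2.2,
    fun a b hab => (hne a b hab).mono ?_⟩
  exact inter_subset_inter (iInter₂_mono fun _ _ => interior_subset)
    (iInter₂_mono fun _ _ => compl_subset_compl.mpr subset_closure)

open Set Topology in
/-- A compact space without a countable local π-base at some point contains long free sequences. -/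
theorem exists_free_sequence {Y I : Type*} [TopologicalSpace Y] [CompactSpace Y] [RegularSpace Y]
    [LinearOrder I] [WellFoundedLT I] (hI : ∀ i : I, (Iio i).Countable) {p : Y}
    (hp : ¬ ∃ B : Set (Set Y), B.Countable ∧ IsLocalPiBase p B) :
    ∃ x : I → Y, ∀ i, Disjoint (closure (x '' Iic i)) (closure (x '' Ioi i)) := by
  classical
  obtain ⟨K, V, hKc, hVo, hKV, hne⟩ := exists_independent_neighborhoods hI hp
  have hx : ∀ i, ∃ y, ∀ j, (j < i → y ∈ K j) ∧ (i ≤ j → y ∉ V j) := by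
    intro i
    have hcl : ∀ j, IsClosed (if j < i then K j else (V j)ᶜ) := fun j => by
      split_ifs
      exacts [hKc j, (hVo j).isClosed_compl]
    obtain ⟨y, hy⟩ := CompactSpace.iInter_nonempty hcl fun u => by
      refine (hne (u.filter (· < i)) (u.filter (i ≤ ·)) ?_).mono ?_
      · intro j hj k hk
        exact (Finset.mem_filter.mp hj).2.trans_le (Finset.mem_filter.mp hk).2
      · rintro y ⟨h1, h2⟩
        simp only [mem_iInter, Finset.mem_filter] at h1 h2 ⊢
        intro j hj
        split_ifs with h
        exacts [h1 j ⟨hj, h⟩, h2 j ⟨hj, not_lt.mp h⟩]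
    refine ⟨y, fun j => ?_⟩
    have := mem_iInter.mp hy j
    refine ⟨fun h => by rwa [if_pos h] at this, fun h => by rwa [if_neg h.not_gt] at this⟩
  choose x hx using hx
  refine ⟨x, fun i => ?_⟩
  have h1 : closure (x '' Iic i) ⊆ (V i)ᶜ := closure_minimal
    (by rintro _ ⟨j, hj, rfl⟩; exact (hx j i).2 hj) (hVo i).isClosed_compl
  have h2 : closure (x '' Ioi i) ⊆ K i := closure_minimal
    (by rintro _ ⟨j, hj, rfl⟩; exact (hx j i).1 hj) (hKc i)
  exact disjoint_left.mpr fun y hy1 hy2 => h1 hy1 (hKV i (h2 hy2))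

open Set in
theorem countable_Iio_omega_one (i : (Ordinal.omega 1).ToType) : (Iio i).Countable := by
  rw [← Cardinal.le_aleph0_iff_set_countable, ← Order.lt_succ_iff, Cardinal.succ_aleph0]
  simpa using Cardinal.mk_Iio_lt i (by simp)

open Set in
theorem exists_forall_lt_of_countable_omega_one {E : Set (Ordinal.omega 1).ToType}
    (hE : E.Countable) : ∃ i, ∀ e ∈ E, e < i := by
  by_contra! h
  have huniv : (univ : Set (Ordinal.omega 1).ToType) = ⋃ e ∈ E, Iic e := by
    refine (eq_univ_of_forall fun i => ?_).symm
    obtain ⟨e, he, hi⟩ := h i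
    exact mem_biUnion he hi
  have hc : (univ : Set (Ordinal.omega 1).ToType).Countable :=
    huniv ▸ hE.biUnion fun e _ => Iio_insert (a := e) ▸ (countable_Iio_omega_one e).insert e
  rw [countable_univ_iff, ← Cardinal.mk_le_aleph0_iff] at hc
  simp [Cardinal.aleph0_lt_aleph_one.not_ge] at hc

open Set Topology in
/-- Šapirovskiĭ: countably tight compact Hausdorff spaces have countable π-character. -/
theorem CountablyTightSpace.exists_countable_isLocalPiBase {Y : Type*} [TopologicalSpace Y]
    [CompactSpace Y] [T2Space Y] (hY : CountablyTightSpace Y) (p : Y) :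
    ∃ B : Set (Set Y), B.Countable ∧ IsLocalPiBase p B := by
  by_contra hp
  obtain ⟨x, hx⟩ := exists_free_sequence countable_Iio_omega_one.{0} hp
  have hnonempty : ∀ i, (Ioi i : Set (Ordinal.omega 1).ToType).Nonempty :=
    fun i => (exists_forall_lt_of_countable_omega_one (countable_singleton i)).imp
      fun j hj => hj i rfl
  have hne : Nonempty (Ordinal.omega 1).ToType :=
    ⟨(exists_forall_lt_of_countable_omega_one countable_empty).choose⟩
  -- By compactness `z` is in the closure of every tail; tightness will put it in the closure of an
  -- initial segment too.
  obtain ⟨z, hz⟩ := IsCompact.nonempty_iInter_of_directed_nonempty_isCompact_isClosed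
    (fun i => closure (x '' Ioi i))
    (directed_of_isDirected_le fun i j hij =>
      closure_mono (image_mono (Ioi_subset_Ioi hij)))
    (fun i => ((hnonempty i).image x).closure) (fun _ => isClosed_closure.isCompact)
    (fun _ => isClosed_closure)
  rw [mem_iInter] at hz
  obtain ⟨E, hE, hEc, hzE⟩ := hY z (range x)
    (closure_mono (image_subset_range _ _) (hz hne.some))
  have hE' : ∀ y ∈ E, ∃ i, x i = y := fun y hy => hE hy
  choose! g hg using hE'
  obtain ⟨i, hi⟩ := exists_forall_lt_of_countable_omega_one (hEc.image g)
  refine disjoint_left.mp (hx i) (closure_mono (fun y hy => ?_) hzE) (hz i)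
  exact ⟨g y, (hi _ (mem_image_of_mem g hy)).le, hg y hy⟩

theorem mainTheorem12 {X : Type*} {Y : Type*} [TopologicalSpace X] [TopologicalSpace Y]
    [CompactSpace X] [T2Space X] [TopologicalSpace.SeparableSpace X] [T2Space Y]
    (hX : ScatteredSpace X ∨ CountablyTightSpace X)
    (f : X → Y) (hf : Continuous f) (hf_surj : Function.Surjective f) :
    SSeparableSpace Y := by
  have : TopologicalSpace.SeparableSpace Y := hf_surj.denseRange.separableSpace hf
  have : CompactSpace Y := hf_surj.compactSpace hf
  obtain ⟨B, hBc, hB⟩ : ∃ B : Set (Set Y), B.Countable ∧ IsPiBase B := by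
    rcases hX with hX | hX
    · exact exists_countable_isPiBase_of_dense_isolated fun U hU hne =>
        hX.exists_isOpen_singleton hf hf_surj hU hne
    · exact exists_countable_isPiBase_of_isLocalPiBase
        (hX.of_isClosedMap hf hf.isClosedMap hf_surj).exists_countable_isLocalPiBase
  exact hB.sSeparableSpace hBc
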